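/- Let $p$ be a prime, let $G$ be a finite $p$-group, and let $\chi,\psi$ be irreducible complex characters of $G$. Let $\eta(\chi\psi)$ denote the number of distinct irreducible constituents of the product character $\chi\psi$, that is, of irreducible complex characters $\theta$ of $G$ with $[\chi\psi,\theta]=\frac{1}{|G|}\sum_{g\in G}\chi(g)\psi(g)\overline{\theta(g)}\neq 0$. For a character $\phi$ of $G$ write $\mathbf{Z}(\phi)=\{g\in G : |\phi(g)|=\phi(1)\}$ and $\operatorname{V}(\phi)=\langle g\in G : \phi(g)\neq 0\rangle$. Assume that $\eta(\chi\psi)<p$, and let $\theta$ be an irreducible constituent of $\chi\psi$. Then (i) $\mathbf{Z}(\chi\psi)=\mathbf{Z}(\theta)$; (ii) $\operatorname{V}(\chi\psi)\geq\operatorname{V}(\theta)$, and therefore $\operatorname{V}(\chi)\cap\operatorname{V}(\psi)\geq\operatorname{V}(\theta)$. -/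

import Mathlib

namespace FiniteGroupChar

noncomputable section

/-- `Irr(G)`: the set of irreducible complex characters of `G`, that is, of the functions
`g ↦ trace (ρ g)`, for `ρ` an irreducible finite-dimensional complex representation of `G`. -/
def Irr (G : Type*) [Group G] : Set (G → ℂ) :=
  {χ | ∃ (V : Type) (_ : AddCommGroup V) (_ : Module ℂ V) (_ : FiniteDimensional ℂ V)
      (ρ : Representation ℂ G V), ρ.IsIrreducible ∧ ρ.character = χ}

/-- The inner product `[φ, θ] = |G|⁻¹ ∑ g, φ(g) * conj (θ(g))` of functions on `G`. -/
def charInner {G : Type*} [Fintype G] (φ θ : G → ℂ) : ℂ :=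
  (Fintype.card G : ℂ)⁻¹ * ∑ g : G, φ g * (starRingEnd ℂ) (θ g)

/-- The set of (distinct) irreducible constituents of `φ`. -/
def constituents {G : Type*} [Group G] [Fintype G] (φ : G → ℂ) : Set (G → ℂ) :=
  {θ | θ ∈ Irr G ∧ charInner φ θ ≠ 0}

/-- `η(φ)`: the number of distinct irreducible constituents of `φ`. -/
def eta {G : Type*} [Group G] [Fintype G] (φ : G → ℂ) : ℕ∞ :=
  (constituents φ).encard

/-- The center `Z(φ) = {g ∈ G : |φ(g)| = φ(1)}` of a character `φ`, as a subset of `G`. -/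
def center {G : Type*} [Group G] (φ : G → ℂ) : Set G :=
  {g | ((‖φ g‖ : ℝ) : ℂ) = φ 1}

/-- `V(φ)`: the subgroup generated by the elements on which `φ` does not vanish. -/
def V {G : Type*} [Group G] (φ : G → ℂ) : Subgroup G :=
  Subgroup.closure {g | φ g ≠ 0}

end

end FiniteGroupChar

/-!
Everything follows from one principle (`constituent_eq_zero_of_commutator_le`). Let `φ` be a
character of the `p`-group `G` with fewer than `p` constituents, let `K/N` be a central section of
`G`, and suppose that `φ` vanishes on `K \ N`. Then so does every constituent `θ` of `φ`.

For the proof, let `μ` be a linear character of the abelian group `K/N`. It is `G`-invariant, and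
`φ μ = φ` on `K`. Restricted to the `G`-classes in `K`, `φ` is a combination, with positive
coefficients, of the central characters `ω_θ = θ / θ(1)` of its constituents. These are
multiplicative, and multiplication by `μ` permutes them by Dedekind's independence theorem
(`exists_eq_mul_of_sum_eq`). There are fewer than `p` of them, whereas `μ` has order a power of
`p`, so `ω_θ μ = ω_θ`. If `k` is in `K \ N`, some `μ` has `μ(k) ≠ 1`, whence `θ(k) = 0`.

To obtain `V(θ) ≤ N = V(χψ)`, the principle is applied to the sections `γₙ(G) N / γₙ₊₁(G) N`
given by the lower central series. For the centers, `Z = Z(χψ) = Z(χ) ∩ Z(ψ)` lies in `Z(θ)` by the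
triangle inequality. Let `K/Z` be the center of `G/Z`. If `k` is in `K` and `χ(k) ψ(k) ≠ 0`, then `k`
is in `Z` (`mem_scalarSubgroup_of_commutator`), so `θ` vanishes on `K \ Z` by the principle. But
`θ` vanishes nowhere on `Z(θ)`. So the normal subgroup `Z(θ)/Z` of the nilpotent group `G/Z` meets
its center trivially, and is therefore trivial.
-/

namespace FiniteGroupChar

open Module Representation

/-! ### Eigenvalues and centers of characters -/

theorem exists_basis_eigenvectors {V : Type*} [AddCommGroup V] [Module ℂ V]
    [FiniteDimensional ℂ V] {f : End ℂ V} {n : ℕ} (hn : n ≠ 0) (hf : f ^ n = 1) :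
    ∃ (b : Basis (Fin (finrank ℂ V)) ℂ V) (c : Fin (finrank ℂ V) → ℂ),
      (∀ i, ‖c i‖ = 1) ∧ ∀ i, f (b i) = c i • b i := by
  have hss : f.IsSemisimple := by
    refine End.isSemisimple_of_squarefree_aeval_eq_zero
      (p := (Polynomial.X ^ n - Polynomial.C (1 : ℂ))) ?_ (by simp [hf])
    exact (Polynomial.separable_X_pow_sub_C _ (by exact_mod_cast hn) one_ne_zero).squarefree
  let s : Set V := {v | ∃ c : ℂ, f v = c • v}
  have hs : ⊤ ≤ Submodule.span ℂ s := by
    rw [← hss.iSup_eigenspace_eq_top]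
    refine iSup_le fun c v hv => Submodule.subset_span ⟨c, ?_⟩
    exact End.mem_eigenspace_iff.mp hv
  let := FiniteDimensional.fintypeBasisIndex (Basis.ofSpan hs)
  let b := (Basis.ofSpan hs).reindex
    (Fintype.equivFinOfCardEq (finrank_eq_card_basis (Basis.ofSpan hs)).symm)
  have hc : ∀ i, ∃ c : ℂ, f (b i) = c • b i := fun i =>
    Basis.ofSpan_subset hs ⟨_, (Basis.reindex_apply ..).symm⟩
  choose c hc using hc
  refine ⟨b, c, fun i => ?_, hc⟩
  have hpow : ∀ m : ℕ, (f ^ m) (b i) = c i ^ m • b i := by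
    intro m
    induction m with
    | zero => simp
    | succ m ih => rw [pow_succ', End.mul_apply, ih, map_smul, hc, smul_smul, pow_succ]
  refine Complex.norm_eq_one_of_pow_eq_one (n := n) ?_ hn
  have h := hpow n
  rw [hf, End.one_apply] at h
  have h' : (c i ^ n - 1) • b i = 0 := by rw [sub_smul, one_smul, ← h, sub_self]
  exact sub_eq_zero.mp ((smul_eq_zero.mp h').resolve_right (b.ne_zero i))

theorem trace_eq_sum_of_eigenbasis {V ι : Type*} [AddCommGroup V] [Module ℂ V] [Fintype ι]
    (b : Basis ι ℂ V) {f : End ℂ V} {c : ι → ℂ} (h : ∀ i, f (b i) = c i • b i) :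
    LinearMap.trace ℂ V f = ∑ i, c i := by
  classical
  rw [LinearMap.trace_eq_matrix_trace ℂ b, Matrix.trace]
  refine Finset.sum_congr rfl fun i _ => ?_
  simp [LinearMap.toMatrix_apply, h]

/-- Equality in the triangle inequality for unit complex numbers: the variance of the family
`c` about its mean is `0`. -/
theorem eq_of_norm_sum_eq_card {ι : Type*} [Fintype ι] {c : ι → ℂ} (hc : ∀ i, ‖c i‖ = 1)
    (h : ‖∑ i, c i‖ = Fintype.card ι) (i : ι) : c i = (∑ i, c i) / Fintype.card ι := by
  have : Nonempty ι := ⟨i⟩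
  set n : ℝ := (Fintype.card ι : ℝ) with hn
  have hn0 : n ≠ 0 := by simp [hn]
  set s := ∑ i, c i with hs
  have key : ∑ i, ‖c i - s / n‖ ^ 2 = 0 := by
    have h1 : ∀ i, ‖c i - s / n‖ ^ 2 = 2 - 2 / n * (inner ℝ (c i) s) := by
      intro i
      have h5 : ‖s / n‖ = 1 := by
        rw [norm_div, h, Complex.norm_real, Real.norm_of_nonneg (by simp [hn]), div_self hn0]
      rw [norm_sub_sq_real, hc, h5]
      have : s / n = (n⁻¹ : ℝ) • s := by
        rw [Complex.real_smul, Complex.ofReal_inv]; ring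
      rw [this, real_inner_smul_right]
      ring
    rw [Finset.sum_congr rfl fun i _ => h1 i, Finset.sum_sub_distrib, ← Finset.mul_sum,
      ← sum_inner, ← hs, real_inner_self_eq_norm_sq, h]
    simp
    field_simp
    ring
  have h2 := (Finset.sum_eq_zero_iff_of_nonneg fun i _ => by positivity).mp key i (Finset.mem_univ i)
  have h3 : c i - s / n = 0 := by simpa using h2
  simpa [hn] using sub_eq_zero.mp h3

section Character

variable {G W : Type*} [Group G] [AddCommGroup W] [Module ℂ W] (ρ : Representation ℂ G W)

theorem exists_basis_eigenvectors_apply [Finite G] [FiniteDimensional ℂ W] (g : G) :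
    ∃ (b : Basis (Fin (finrank ℂ W)) ℂ W) (c : Fin (finrank ℂ W) → ℂ),
      (∀ i, ‖c i‖ = 1) ∧ ∀ i, ρ g (b i) = c i • b i :=
  exists_basis_eigenvectors (orderOf_pos g).ne' (by rw [← map_pow, pow_orderOf_eq_one, map_one])

theorem conj_character [Finite G] [FiniteDimensional ℂ W] (g : G) :
    (starRingEnd ℂ) (ρ.character g) = ρ.character g⁻¹ := by
  obtain ⟨b, c, hc, hb⟩ := exists_basis_eigenvectors_apply ρ g
  have hinv : ∀ i, ρ g⁻¹ (b i) = (c i)⁻¹ • b i := by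
    intro i
    have h0 : c i ≠ 0 := norm_ne_zero_iff.mp (by simp [hc])
    have h1 : ρ g⁻¹ (ρ g (b i)) = b i := by
      rw [← End.mul_apply, ← map_mul, inv_mul_cancel, map_one, End.one_apply]
    rw [hb, map_smul] at h1
    rw [eq_inv_smul_iff₀ h0, h1]
  rw [character, character, trace_eq_sum_of_eigenbasis b hb, trace_eq_sum_of_eigenbasis b hinv,
    map_sum]
  exact Finset.sum_congr rfl fun i _ => (Complex.inv_eq_conj (hc i)).symm

theorem norm_character_le [Finite G] [FiniteDimensional ℂ W] (g : G) :
    ‖ρ.character g‖ ≤ finrank ℂ W := by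
  obtain ⟨b, c, hc, hb⟩ := exists_basis_eigenvectors_apply ρ g
  rw [character, trace_eq_sum_of_eigenbasis b hb]
  exact (norm_sum_le _ _).trans (by simp [hc])

/-- The center of a character is the set of elements acting as scalars. -/
theorem norm_character_eq_iff [Finite G] [FiniteDimensional ℂ W] (g : G) :
    ‖ρ.character g‖ = finrank ℂ W ↔ ∃ c : ℂ, ρ g = c • 1 := by
  obtain ⟨b, c, hc, hb⟩ := exists_basis_eigenvectors_apply ρ g
  rw [character, trace_eq_sum_of_eigenbasis b hb]
  constructor
  · intro h
    refine ⟨(∑ i, c i) / Fintype.card (Fin (finrank ℂ W)), b.ext fun i => ?_⟩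
    rw [hb, LinearMap.smul_apply, End.one_apply]
    exact congrArg (· • b i) (eq_of_norm_sum_eq_card hc (by rw [h, Fintype.card_fin]) i)
  · rintro ⟨d, hd⟩
    have hcd : ∀ i, c i = d := by
      intro i
      have h := hb i
      rw [hd, LinearMap.smul_apply, End.one_apply] at h
      exact (smul_left_injective ℂ (b.ne_zero i) h).symm
    rcases isEmpty_or_nonempty (Fin (finrank ℂ W)) with hι | ⟨⟨i⟩⟩
    · have h0 : finrank ℂ W = 0 := (Fintype.card_fin _).symm.trans (Fintype.card_eq_zero_iff.mpr hι)
      simp [h0]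
    · have : ‖d‖ = 1 := hcd i ▸ hc i
      simp [hcd, this]

/-- Schur's lemma, for endomorphisms. -/
theorem exists_eq_smul_one_of_commute [FiniteDimensional ℂ W] [ρ.IsIrreducible] (f : End ℂ W)
    (hf : ∀ g, f * ρ g = ρ g * f) : ∃ c : ℂ, f = c • 1 := by
  obtain ⟨c, hc⟩ := (IsIrreducible.algebraMap_intertwiningMap_bijective_of_isAlgClosed).2 ⟨f, fun g => hf g⟩
  refine ⟨c, ?_⟩
  have := congrArg IntertwiningMap.toLinearMap hc
  simp only at this
  rw [← this, Algebra.algebraMap_eq_smul_one]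
  rfl

theorem character_smul_one_mul {g : G} {c : ℂ} (h : ρ g = c • 1) (x : G) :
    ρ.character (g * x) = c * ρ.character x := by
  rw [character, map_mul, h, smul_mul_assoc, one_mul, map_smul, smul_eq_mul, character]

theorem finrank_pos_of_isIrreducible [FiniteDimensional ℂ W] [ρ.IsIrreducible] :
    0 < finrank ℂ W := by
  rw [Module.finrank_pos_iff]
  by_contra h
  rw [not_nontrivial_iff_subsingleton] at h
  exact bot_ne_top (α := Subrepresentation ρ) (SetLike.ext fun x => by
    rw [Subsingleton.elim x 0]
    exact ⟨fun _ => (⊤ : Subrepresentation ρ).toSubmodule.zero_mem,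
      fun _ => (⊥ : Subrepresentation ρ).toSubmodule.zero_mem⟩)

/-- The class sum of `k` acts on an irreducible representation as a scalar, so averaging
`χ (x * gkg⁻¹)` over `g` multiplies `χ x` by the central character value `χ k / χ 1`. -/
theorem sum_character_mul_conj [Fintype G] [FiniteDimensional ℂ W] [ρ.IsIrreducible] (x k : G) :
    ∑ g : G, ρ.character (x * (g * k * g⁻¹)) =
      Fintype.card G * (ρ.character x * (ρ.character k / ρ.character 1)) := by
  have h0 : (finrank ℂ W : ℂ) ≠ 0 := by exact_mod_cast (finrank_pos_of_isIrreducible ρ).ne'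
  obtain ⟨c, hc⟩ := exists_eq_smul_one_of_commute ρ (∑ g : G, ρ (g * k * g⁻¹)) (by
    intro h
    rw [Finset.sum_mul, Finset.mul_sum]
    refine Fintype.sum_bijective (h⁻¹ * ·) (Group.mulLeft_bijective _) _ _ fun g => ?_
    rw [← map_mul, ← map_mul]
    congr 1
    group)
  have h1 : Fintype.card G * ρ.character k = c * finrank ℂ W := by
    have := congrArg (LinearMap.trace ℂ W) hc
    rw [map_sum, map_smul, LinearMap.trace_one, smul_eq_mul] at this
    rw [← this]
    have h2 : ∀ g, LinearMap.trace ℂ W (ρ (g * k * g⁻¹)) = ρ.character k :=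
      fun g => char_conj ρ k g
    rw [Finset.sum_congr rfl fun g _ => h2 g]
    simp
  have h3 : ∑ g : G, ρ.character (x * (g * k * g⁻¹)) = c * ρ.character x := by
    simp_rw [character, map_mul ρ x]
    rw [← map_sum, ← Finset.mul_sum, hc, mul_smul_comm, mul_one, map_smul, smul_eq_mul]
  rw [h3, char_one]
  field_simp
  linear_combination (-ρ.character x) * h1

end Character

/-! ### Decomposition into irreducible characters -/

section Irr

variable {G : Type*} [Group G]

theorem charInner_of_mem_Irr [Fintype G] [DecidableEq (G → ℂ)] {θ θ' : G → ℂ} (h : θ ∈ Irr G)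
    (h' : θ' ∈ Irr G) : charInner θ θ' = if θ = θ' then 1 else 0 := by
  obtain ⟨U, _, _, _, ρ, hρ, rfl⟩ := h
  obtain ⟨W, _, _, _, σ, hσ, rfl⟩ := h'
  have : Invertible (Nat.card G : ℂ) := invertibleOfNonzero (by simp)
  have key : ∀ (U W : Type) [AddCommGroup U] [Module ℂ U] [FiniteDimensional ℂ U]
      [AddCommGroup W] [Module ℂ W] [FiniteDimensional ℂ W] (ρ : Representation ℂ G U)
      (σ : Representation ℂ G W) [ρ.IsIrreducible] [σ.IsIrreducible] [Decidable (Nonempty (Equiv σ ρ))],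
      charInner ρ.character σ.character = if Nonempty (Equiv σ ρ) then 1 else 0 := by
    intro U W _ _ _ _ _ _ ρ σ _ _ _
    have := char_orthonormal ρ σ
    simp only [charInner, conj_character, Fintype.card_eq_nat_card, this]
    congr
  classical
  by_cases heq : ρ.character = σ.character
  · rw [if_pos heq, ← heq, key U U ρ ρ, if_pos ⟨Representation.Equiv.refl ρ⟩]
  · rw [if_neg heq, key U W ρ σ, if_neg fun ⟨e⟩ => heq (char_iso e).symm]

theorem character_eq_add_of_isCompl {W : Type*} [AddCommGroup W] [Module ℂ W]
    [FiniteDimensional ℂ W] (ρ : Representation ℂ G W) {σ τ : Subrepresentation ρ}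
    (h : IsCompl σ.toSubmodule τ.toSubmodule) :
    ρ.character = σ.toRepresentation.character + τ.toRepresentation.character := by
  ext g
  have h1 : (Submodule.prodEquivOfIsCompl _ _ h).conj
      ((σ.toRepresentation g).prodMap (τ.toRepresentation g)) = ρ g := by
    rw [LinearEquiv.conj_apply]
    ext x
    obtain ⟨y, rfl⟩ := (Submodule.prodEquivOfIsCompl _ _ h).surjective x
    simp [Subrepresentation.toRepresentation]
  rw [Pi.add_apply, character, character, character, ← LinearMap.trace_prodMap',
    ← LinearMap.trace_conj' _ (Submodule.prodEquivOfIsCompl _ _ h), h1]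

theorem exists_multiset_irr_sum_eq_character [Finite G] (U : Type) [AddCommGroup U] [Module ℂ U]
    [FiniteDimensional ℂ U] (ρ : Representation ℂ G U) :
    ∃ s : Multiset (G → ℂ), (∀ θ ∈ s, θ ∈ Irr G) ∧ ρ.character = s.sum := by
  obtain ⟨n, hn⟩ : ∃ n, finrank ℂ U = n := ⟨_, rfl⟩
  induction n using Nat.strong_induction_on generalizing U with
  | _ n ih =>
  by_cases hirr : ρ.IsIrreducible
  · exact ⟨{ρ.character}, by simpa using ⟨U, ‹_›, ‹_›, ‹_›, ρ, hirr, rfl⟩, by simp⟩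
  rcases subsingleton_or_nontrivial U with hU | hU
  · refine ⟨0, by simp, funext fun g => ?_⟩
    rw [character, Subsingleton.elim (ρ g) 0]
    simp
  have hnt : Nontrivial (Subrepresentation ρ) := by
    refine ⟨⊥, ⊤, fun h => ?_⟩
    exact bot_ne_top (α := Submodule ℂ U) (congrArg Subrepresentation.toSubmodule h)
  have : ∃ σ : Subrepresentation ρ, σ ≠ ⊥ ∧ σ ≠ ⊤ := by
    by_contra! h
    exact hirr { eq_bot_or_eq_top := fun σ => or_iff_not_imp_left.mpr (h σ) }
  obtain ⟨σ, hbot, htop⟩ := this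
  obtain ⟨τ, hτ⟩ := exists_isCompl σ
  have hc : IsCompl σ.toSubmodule τ.toSubmodule := by
    refine ⟨disjoint_iff.mpr ?_, codisjoint_iff.mpr ?_⟩
    · exact congrArg Subrepresentation.toSubmodule (disjoint_iff.mp hτ.1)
    · exact congrArg Subrepresentation.toSubmodule (codisjoint_iff.mp hτ.2)
  have hdim := Submodule.finrank_add_eq_of_isCompl hc
  have hσ : finrank ℂ σ.toSubmodule < n := by
    rw [← hn]
    exact Submodule.finrank_lt fun h => htop (Subrepresentation.toSubmodule_injective h)
  have hσ0 : 0 < finrank ℂ σ.toSubmodule := by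
    rw [Nat.pos_iff_ne_zero, Ne, Submodule.finrank_eq_zero]
    exact fun h => hbot (Subrepresentation.toSubmodule_injective h)
  obtain ⟨s, hs, hs'⟩ := ih _ hσ _ σ.toRepresentation rfl
  obtain ⟨t, ht, ht'⟩ := ih (finrank ℂ τ.toSubmodule) (by omega) _ τ.toRepresentation rfl
  refine ⟨s + t, fun θ hθ => ?_, ?_⟩
  · exact (Multiset.mem_add.mp hθ).elim (hs θ) (ht θ)
  · rw [character_eq_add_of_isCompl ρ hc, hs', ht', Multiset.sum_add]

omit [Group G] in
theorem charInner_finset_sum [Fintype G] {ι : Type*} (s : Finset ι) (a : ι → ℂ)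
    (f : ι → G → ℂ) (θ : G → ℂ) :
    charInner (∑ i ∈ s, a i • f i) θ = ∑ i ∈ s, a i * charInner (f i) θ := by
  simp only [charInner, Finset.sum_apply, Pi.smul_apply, smul_eq_mul, Finset.sum_mul,
    Finset.mul_sum]
  rw [Finset.sum_comm]
  exact Finset.sum_congr rfl fun i _ => Finset.sum_congr rfl fun g _ => by ring

/-- A character is the combination of its constituents with positive integer multiplicities.
The constituents, defined through the inner product, thus form a finite set. -/
theorem exists_eq_sum_constituents [Fintype G] {U : Type} [AddCommGroup U] [Module ℂ U]
    [FiniteDimensional ℂ U] (ρ : Representation ℂ G U) :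
    ∃ (I : Finset (G → ℂ)) (m : (G → ℂ) → ℕ), (I : Set (G → ℂ)) = constituents ρ.character ∧
      (∀ θ ∈ I, 0 < m θ) ∧ ρ.character = ∑ θ ∈ I, (m θ : ℂ) • θ := by
  classical
  obtain ⟨s, hs, hsum⟩ := exists_multiset_irr_sum_eq_character U ρ
  have hdec : ρ.character = ∑ θ ∈ s.toFinset, (s.count θ : ℂ) • θ := by
    rw [hsum, Finset.sum_multiset_count]
    simp only [Nat.cast_smul_eq_nsmul]
  refine ⟨s.toFinset, s.count, Set.ext fun θ => ?_, fun θ hθ => ?_, hdec⟩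
  · have hcount : θ ∈ Irr G → charInner ρ.character θ = s.count θ := by
      intro hθ
      rw [hdec, charInner_finset_sum, Finset.sum_congr rfl fun i hi => by
        rw [charInner_of_mem_Irr (hs i (Multiset.mem_toFinset.mp hi)) hθ]]
      simp +contextual
    rw [Finset.mem_coe, Multiset.mem_toFinset]
    constructor
    · intro h
      refine ⟨hs θ h, ?_⟩
      rw [hcount (hs θ h)]
      exact_mod_cast (Multiset.count_pos.mpr h).ne'
    · rintro ⟨h, h0⟩
      rw [hcount h] at h0
      exact Multiset.count_pos.mp (Nat.pos_of_ne_zero (by exact_mod_cast h0))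
  · exact Multiset.count_pos.mpr (Multiset.mem_toFinset.mp hθ)

end Irr

/-! ### Twisting central characters -/

/-- If a positive combination of multiplicative characters `F i` is unchanged when every `F i` is
multiplied by `U`, then the set of the `F i` is stable under multiplication by `U`: by Dedekind's
theorem the two combinations have the same coefficients, and positivity excludes cancellation
among equal characters. -/
theorem exists_eq_mul_of_sum_eq {M ι : Type*} [Monoid M] {I : Finset ι} {a : ι → ℝ}
    (ha : ∀ i ∈ I, 0 < a i) (F : ι → M →* ℂ) (U : M →* ℂ)
    (h : ∀ w, ∑ i ∈ I, (a i : ℂ) * F i w = ∑ i ∈ I, (a i : ℂ) * (F i w * U w)) {i : ι}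
    (hi : i ∈ I) : ∃ j ∈ I, F j = F i * U := by
  classical
  have hli := linearIndependent_monoidHom M ℂ
  have heq : (∑ i ∈ I, Finsupp.single (F i) (a i : ℂ)) =
      ∑ i ∈ I, Finsupp.single (F i * U) (a i : ℂ) := by
    apply hli
    simp only [map_sum, Finsupp.linearCombination_single]
    funext w
    simpa using h w
  by_contra! hne
  have h1 := DFunLike.congr_fun heq (F i * U)
  rw [Finsupp.finsetSum_apply, Finsupp.finsetSum_apply,
    Finset.sum_eq_zero fun j hj => Finsupp.single_eq_of_ne (hne j hj).symm] at h1
  have h2 : 0 < ∑ j ∈ I, if F j * U = F i * U then a j else 0 := by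
    refine Finset.sum_pos' (fun j hj => ?_) ⟨i, hi, by simpa using ha i hi⟩
    split_ifs
    exacts [(ha j hj).le, le_rfl]
  refine h2.ne ?_
  have h3 : (0 : ℂ) = ((∑ j ∈ I, if F j * U = F i * U then a j else 0 : ℝ) : ℂ) := by
    rw [h1, Complex.ofReal_sum]
    refine Finset.sum_congr rfl fun j _ => ?_
    rw [Finsupp.single_apply]
    split_ifs <;> simp
  exact_mod_cast h3

section Average

variable {G : Type*} [Group G] [Fintype G]

/-- `conjAverage φ [k₁, …, kₙ] x` is the mean of `φ (x * k₁^{g₁} * ⋯ * kₙ^{gₙ})` over all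
`g₁, …, gₙ` in `G`, where `k^g = gkg⁻¹`. If `φ` is the character of a representation, this is
the trace of `x` times the images of the averaged classes of the `kᵢ`, which are central. -/
noncomputable def conjAverage (φ : G → ℂ) : List G → G → ℂ
  | [], x => φ x
  | k :: w, x => (Fintype.card G : ℂ)⁻¹ * ∑ g : G, conjAverage φ w (x * (g * k * g⁻¹))

theorem conjAverage_of_mem_Irr {θ : G → ℂ} (hθ : θ ∈ Irr G) (w : List G) (x : G) :
    conjAverage θ w x = θ x * (w.map fun k => θ k / θ 1).prod := by
  obtain ⟨U, _, _, _, ρ, hρ, rfl⟩ := hθ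
  induction w generalizing x with
  | nil => simp [conjAverage]
  | cons k w ih =>
    have : (Fintype.card G : ℂ) ≠ 0 := by simp
    simp only [conjAverage, ih, List.map_cons, List.prod_cons]
    rw [← Finset.sum_mul, sum_character_mul_conj]
    field_simp

theorem conjAverage_finset_sum {ι : Type*} (s : Finset ι) (a : ι → ℂ) (f : ι → G → ℂ)
    (w : List G) (x : G) :
    conjAverage (∑ i ∈ s, a i • f i) w x = ∑ i ∈ s, a i * conjAverage (f i) w x := by
  induction w generalizing x with
  | nil => simp [conjAverage]
  | cons k w ih =>
    simp only [conjAverage, ih, Finset.mul_sum]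
    rw [Finset.sum_comm]
    exact Finset.sum_congr rfl fun i _ => Finset.sum_congr rfl fun g _ => by ring

/-- If `φ` is unchanged on `K` by multiplication with a `G`-invariant linear character `μ` of `K`,
then so are its averages, because `μ` is constant on each `G`-class. -/
theorem conjAverage_mul_eq {K : Subgroup G} [K.Normal] {μ : K →* ℂˣ}
    (hμ : ∀ (g : G) (k k' : K), (k' : G) = g * k * g⁻¹ → μ k' = μ k) {φ : G → ℂ}
    (hφ : ∀ k : K, φ k * μ k = φ k) (w : List K) (x : K) :
    conjAverage φ (w.map (↑)) x * (μ x * (w.map fun k => (μ k : ℂ)).prod) =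
      conjAverage φ (w.map (↑)) x := by
  induction w generalizing x with
  | nil => simpa [conjAverage] using hφ x
  | cons k w ih =>
    simp only [List.map_cons, conjAverage, List.prod_cons]
    rw [mul_assoc, Finset.sum_mul]
    congr 1
    refine Finset.sum_congr rfl fun g _ => ?_
    let k' : K := ⟨g * k * g⁻¹, ‹K.Normal›.conj_mem k k.2 g⟩
    have h := ih (x * k')
    rw [map_mul, hμ g k k' rfl] at h
    simp only [Subgroup.coe_mul, Units.val_mul] at h
    linear_combination h

end Average

/-- Let `φ` have fewer than `p` constituents, and let `K/N` be a central section of `G` such that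
`φ` vanishes on `K \ N`. Then every constituent of `φ` vanishes on `K \ N`. -/
theorem constituent_eq_zero_of_commutator_le {G : Type*} [Group G] [Fintype G] {p : ℕ}
    [Fact p.Prime] (hG : IsPGroup p G) {φ : G → ℂ} {I : Finset (G → ℂ)} {m : (G → ℂ) → ℕ}
    (hI : ∀ θ ∈ I, θ ∈ Irr G) (hm : ∀ θ ∈ I, 0 < m θ) (hφ : φ = ∑ θ ∈ I, (m θ : ℂ) • θ)
    (hcard : I.card < p) {K N : Subgroup G} [K.Normal] [N.Normal]
    (hKN : ∀ k ∈ K, ∀ g : G, g * k * g⁻¹ * k⁻¹ ∈ N) (h0 : ∀ k ∈ K, k ∉ N → φ k = 0)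
    {θ : G → ℂ} (hθ : θ ∈ I) {k : G} (hk : k ∈ K) (hkN : k ∉ N) : θ k = 0 := by
  have hcomm : ∀ a b : K ⧸ N.subgroupOf K, a * b = b * a := by
    intro a b
    induction a using QuotientGroup.induction_on with | _ a
    induction b using QuotientGroup.induction_on with | _ b
    rw [← QuotientGroup.mk_mul, ← QuotientGroup.mk_mul, eq_comm, QuotientGroup.eq,
      Subgroup.mem_subgroupOf]
    simpa [mul_assoc] using ‹N.Normal›.conj_mem _ (hKN a a.2 (b : G)⁻¹) (a : G)⁻¹
  let _ : CommGroup (K ⧸ N.subgroupOf K) := { mul_comm := hcomm }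
  obtain ⟨ν, hν⟩ := CommGroup.exists_apply_ne_one_of_hasEnoughRootsOfUnity
    (K ⧸ N.subgroupOf K) ℂ (a := QuotientGroup.mk ⟨k, hk⟩) (by
      rwa [Ne, QuotientGroup.eq_one_iff, Subgroup.mem_subgroupOf])
  let μ : K →* ℂˣ := ν.comp (QuotientGroup.mk' _)
  have hμN : ∀ x : K, (x : G) ∈ N → μ x = 1 := by
    intro x hx
    have : (QuotientGroup.mk x : K ⧸ N.subgroupOf K) = 1 := by
      rwa [QuotientGroup.eq_one_iff, Subgroup.mem_subgroupOf]
    simp [μ, this]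
  have hμinv : ∀ (g : G) (a b : K), (b : G) = g * a * g⁻¹ → μ b = μ a := by
    intro g a b hab
    rw [← mul_inv_eq_one, ← map_inv, ← map_mul]
    exact hμN _ (by simpa [hab] using hKN a a.2 g)
  have hφμ : ∀ x : K, φ x * μ x = φ x := by
    intro x
    by_cases hx : (x : G) ∈ N
    · simp [hμN x hx]
    · simp [h0 x x.2 hx]
  -- Words in `K` replace the center of the group algebra: the central character of `θ` is a
  -- multiplicative function on the free monoid, to which Dedekind's theorem applies.
  let F : (G → ℂ) → FreeMonoid K →* ℂ := fun θ => FreeMonoid.lift fun k => θ k / θ 1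
  let U : FreeMonoid K →* ℂ := FreeMonoid.lift fun k => (μ k : ℂ)
  have hdeg : ∀ θ ∈ I, ∃ d : ℕ, 0 < d ∧ θ 1 = d := by
    intro θ hθ
    obtain ⟨W, _, _, _, ρ, hρ, rfl⟩ := hI θ hθ
    exact ⟨_, finrank_pos_of_isIrreducible ρ, char_one ρ⟩
  choose! d hd0 hd using hdeg
  have hsum : ∀ w, ∑ θ ∈ I, ((m θ * d θ : ℝ) : ℂ) * F θ w =
      ∑ θ ∈ I, ((m θ * d θ : ℝ) : ℂ) * (F θ w * U w) := by
    intro w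
    have h1 : conjAverage φ (w.toList.map (↑)) 1 = ∑ θ ∈ I, ((m θ * d θ : ℝ) : ℂ) * F θ w := by
      rw [hφ, conjAverage_finset_sum]
      refine Finset.sum_congr rfl fun θ hθ => ?_
      rw [conjAverage_of_mem_Irr (hI θ hθ), hd θ hθ]
      simp [F, FreeMonoid.lift_apply, hd θ hθ, mul_assoc]
    have h2 := conjAverage_mul_eq hμinv hφμ w.toList 1
    rw [Subgroup.coe_one, map_one, Units.val_one, one_mul, h1] at h2
    rw [← h2, Finset.sum_mul]
    refine Finset.sum_congr rfl fun θ hθ => ?_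
    rw [mul_assoc]
    simp [U, FreeMonoid.lift_apply]
  have hstep : ∀ θ ∈ I, ∃ θ' ∈ I, F θ' = F θ * U := fun θ hθ =>
    exists_eq_mul_of_sum_eq (a := fun θ => (m θ * d θ : ℝ))
      (fun θ hθ => by have := hm θ hθ; have := hd0 θ hθ; positivity) F U hsum hθ
  have hpow : ∀ n : ℕ, ∃ θ' ∈ I, F θ' = F θ * U ^ n := by
    intro n
    induction n with
    | zero => exact ⟨θ, hθ, by simp⟩
    | succ n ih =>
      obtain ⟨θ₁, h₁, e₁⟩ := ih
      obtain ⟨θ₂, h₂, e₂⟩ := hstep θ₁ h₁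
      exact ⟨θ₂, h₂, by rw [e₂, e₁, pow_succ, mul_assoc]⟩
  choose f hfI hf using hpow
  -- The `p` twists `F θ * U ^ n`, for `n < p`, lie among fewer than `p` functions.
  obtain ⟨a, ha, b, hb, hab, hfab⟩ := Finset.exists_ne_map_eq_of_card_lt_of_maps_to
    (s := Finset.range p) (t := I) (f := f) (by simpa using hcard) (fun n _ => hfI n)
  rw [Finset.mem_range] at ha hb
  wlog hlt : a < b generalizing a b
  · exact this b hb a ha hab.symm hfab.symm (by omega)
  by_contra hne
  have hF : F θ * U ^ a = F θ * U ^ b := by rw [← hf, ← hf, hfab]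
  have hval := DFunLike.congr_fun hF (FreeMonoid.of ⟨k, hk⟩)
  simp only [MonoidHom.mul_apply, MonoidHom.pow_apply, F, U, FreeMonoid.lift_eval_of] at hval
  have hdne : θ 1 ≠ 0 := by rw [hd θ hθ]; exact_mod_cast (hd0 θ hθ).ne'
  have hval' := mul_left_cancel₀ (div_ne_zero hne hdne) hval
  have hu : (μ ⟨k, hk⟩) ^ (b - a) = 1 := by
    have : (μ ⟨k, hk⟩) ^ a = (μ ⟨k, hk⟩) ^ b := Units.ext (by simpa using hval')
    rw [pow_sub _ hlt.le, ← this, mul_inv_cancel]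
  obtain ⟨n, hn⟩ := hG k
  have hu' : (μ ⟨k, hk⟩) ^ p ^ n = 1 := by
    rw [← map_pow, show (⟨k, hk⟩ : K) ^ p ^ n = 1 from Subtype.ext (by simpa using hn), map_one]
  -- The order of `μ k` divides `b - a < p` and a power of `p`, so that `μ k = 1`.
  have hcop : Nat.Coprime (b - a) (p ^ n) := by
    refine Nat.Coprime.pow_right n (Nat.Coprime.symm ?_)
    rw [(Fact.out : p.Prime).coprime_iff_not_dvd]
    exact fun h => absurd (Nat.le_of_dvd (by omega) h) (by omega)
  refine hν ?_
  have := pow_gcd_eq_one.mpr ⟨hu, hu'⟩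
  rw [Nat.Coprime.gcd_eq_one hcop, pow_one] at this
  exact this

/-! ### Central sections of `G` -/

section Center

variable {G : Type*} [Group G]

theorem mem_comap_mk_center_iff {N : Subgroup G} [N.Normal] {k : G} :
    k ∈ (Subgroup.center (G ⧸ N)).comap (QuotientGroup.mk' N) ↔
      ∀ g : G, g * k * g⁻¹ * k⁻¹ ∈ N := by
  rw [Subgroup.mem_comap, Subgroup.mem_center_iff, (QuotientGroup.mk'_surjective N).forall]
  refine forall_congr' fun g => ?_
  rw [← map_mul, ← map_mul, ← mul_inv_eq_one, ← map_inv, ← map_mul, ← MonoidHom.mem_ker,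
    QuotientGroup.ker_mk', mul_inv_rev, ← mul_assoc, ← SetLike.mem_coe]

variable {W : Type*} [AddCommGroup W] [Module ℂ W] (ρ : Representation ℂ G W)

/-- The preimage in `G` of the center of `G / ker ρ`. For irreducible `ρ` it consists of the elements
that `ρ` maps to scalars, and it is the center of the character of `ρ`. -/
def scalarSubgroup : Subgroup G :=
  (Subgroup.center (G ⧸ ρ.ker)).comap (QuotientGroup.mk' ρ.ker)

instance : (scalarSubgroup ρ).Normal := by
  unfold scalarSubgroup
  infer_instance

theorem mem_scalarSubgroup_iff_commute {g : G} :
    g ∈ scalarSubgroup ρ ↔ ∀ h, ρ h * ρ g = ρ g * ρ h := by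
  rw [scalarSubgroup, mem_comap_mk_center_iff]
  refine forall_congr' fun h => ?_
  rw [MonoidHom.mem_ker]
  constructor
  · intro h1
    rw [← map_mul, ← map_mul, show h * g = (h * g * h⁻¹ * g⁻¹) * (g * h) by group, map_mul, h1,
      one_mul]
  · intro h1
    rw [mul_assoc, ← mul_inv_rev, map_mul, map_mul, h1, ← map_mul, ← map_mul, mul_inv_cancel,
      map_one]

variable [FiniteDimensional ℂ W] [ρ.IsIrreducible]

theorem mem_scalarSubgroup_iff {g : G} : g ∈ scalarSubgroup ρ ↔ ∃ c : ℂ, ρ g = c • 1 := by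
  rw [mem_scalarSubgroup_iff_commute]
  constructor
  · exact fun h => exists_eq_smul_one_of_commute ρ _ fun g' => (h g').symm
  · rintro ⟨c, hc⟩ h
    rw [hc, mul_smul_comm, smul_mul_assoc, mul_one, one_mul]

theorem coe_scalarSubgroup [Finite G] : (scalarSubgroup ρ : Set G) = center ρ.character := by
  ext g
  rw [SetLike.mem_coe, mem_scalarSubgroup_iff, ← norm_character_eq_iff, center, Set.mem_ofPred,
    char_one]
  norm_cast

/-- The commutators `[g, k]` act as scalars `c`, and `χ k = χ (gkg⁻¹) = c * χ k` forces `c = 1`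
unless `χ k = 0`. -/
theorem mem_scalarSubgroup_of_commutator {k : G} (h0 : ρ.character k ≠ 0)
    (hk : ∀ g, g * k * g⁻¹ * k⁻¹ ∈ scalarSubgroup ρ) : k ∈ scalarSubgroup ρ := by
  rw [scalarSubgroup, mem_comap_mk_center_iff]
  intro g
  obtain ⟨c, hc⟩ := (mem_scalarSubgroup_iff ρ).mp (hk g)
  have h1 := character_smul_one_mul ρ hc k
  rw [inv_mul_cancel_right, char_conj] at h1
  have : c = 1 := mul_right_cancel₀ h0 (by rw [← h1, one_mul])
  rw [MonoidHom.mem_ker, hc, this, one_smul]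

theorem center_mul [Finite G] {W' : Type*} [AddCommGroup W'] [Module ℂ W']
    [FiniteDimensional ℂ W'] (σ : Representation ℂ G W') [σ.IsIrreducible] :
    center (ρ.character * σ.character) = ↑(scalarSubgroup ρ ⊓ scalarSubgroup σ) := by
  rw [Subgroup.coe_inf, coe_scalarSubgroup, coe_scalarSubgroup]
  ext g
  have h1 := norm_character_le ρ g
  have h2 := norm_character_le σ g
  have h3 : (0 : ℝ) < finrank ℂ W := by exact_mod_cast finrank_pos_of_isIrreducible ρ
  have h4 : (0 : ℝ) < finrank ℂ W' := by exact_mod_cast finrank_pos_of_isIrreducible σ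
  simp only [center, Set.mem_ofPred, Set.mem_inter_iff, Pi.mul_apply, char_one, norm_mul]
  norm_cast
  push_cast
  constructor
  · intro h
    constructor
    · refine h1.antisymm ?_
      by_contra! hlt
      have := mul_lt_mul_of_pos_right hlt h4
      have := mul_le_mul_of_nonneg_left h2 (norm_nonneg (ρ.character g))
      linarith
    · refine h2.antisymm ?_
      by_contra! hlt
      have := mul_lt_mul_of_pos_left hlt h3
      have := mul_le_mul_of_nonneg_right h1 (norm_nonneg (σ.character g))
      linarith
  · rintro ⟨e1, e2⟩
    rw [e1, e2]

theorem norm_le_of_mem_Irr [Finite G] {θ : G → ℂ} (hθ : θ ∈ Irr G) (g : G) :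
    ∃ d : ℕ, 0 < d ∧ θ 1 = d ∧ ‖θ g‖ ≤ d := by
  obtain ⟨U, _, _, _, ρ, hρ, rfl⟩ := hθ
  exact ⟨_, finrank_pos_of_isIrreducible ρ, char_one ρ, norm_character_le ρ g⟩

/-- If the sum takes its largest possible modulus at `g`, then so does each summand. -/
theorem center_sum_subset [Finite G] {I : Finset (G → ℂ)} {m : (G → ℂ) → ℕ}
    (hI : ∀ θ ∈ I, θ ∈ Irr G) (hm : ∀ θ ∈ I, 0 < m θ) {θ : G → ℂ} (hθ : θ ∈ I) :
    center (∑ θ ∈ I, (m θ : ℂ) • θ) ⊆ center θ := by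
  intro g hg
  choose! d hd0 hd hdle using fun θ hθ => norm_le_of_mem_Irr (hI θ hθ) g
  have hone : (∑ θ ∈ I, (m θ : ℂ) • θ) 1 = ((∑ θ ∈ I, (m θ : ℝ) * d θ : ℝ) : ℂ) := by
    rw [Finset.sum_apply, Complex.ofReal_sum]
    exact Finset.sum_congr rfl fun θ hθ => by simp [hd θ hθ]
  rw [center, Set.mem_ofPred, hone, Complex.ofReal_inj] at hg
  have hle : ∀ θ ∈ I, (m θ : ℝ) * ‖θ g‖ ≤ m θ * d θ := fun θ hθ =>
    mul_le_mul_of_nonneg_left (hdle θ hθ) (Nat.cast_nonneg _)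
  have htri : ‖(∑ θ ∈ I, (m θ : ℂ) • θ) g‖ ≤ ∑ θ ∈ I, (m θ : ℝ) * ‖θ g‖ := by
    rw [Finset.sum_apply]
    exact (norm_sum_le _ _).trans_eq (Finset.sum_congr rfl fun θ _ => by simp)
  have heq := (Finset.sum_eq_sum_iff_of_le hle).mp
    ((Finset.sum_le_sum hle).antisymm (hg ▸ htri)) θ hθ
  have hmθ : (m θ : ℝ) ≠ 0 := by exact_mod_cast (hm θ hθ).ne'
  rw [center, Set.mem_ofPred, hd θ hθ, mul_left_cancel₀ hmθ heq, Complex.ofReal_natCast]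

end Center

theorem conj_mul_inv_mem_lowerCentralSeries_succ {G : Type*} [Group G] {n : ℕ} {k : G}
    (hk : k ∈ (⊤ : Subgroup G).lowerCentralSeries n) (g : G) :
    g * k * g⁻¹ * k⁻¹ ∈ (⊤ : Subgroup G).lowerCentralSeries (n + 1) := by
  rw [← commutatorElement_def, Subgroup.lowerCentralSeries_succ, Subgroup.commutator_comm]
  exact Subgroup.commutator_mem_commutator (Subgroup.mem_top g) hk

/-- In a nilpotent group, a normal subgroup `A` lies in `Z` as soon as every element of `A`
that is central modulo `Z` lies in `Z`. -/
theorem le_of_forall_mem_of_commutator {G : Type*} [Group G] [Group.IsNilpotent G]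
    {A Z : Subgroup G} [A.Normal]
    (h : ∀ k ∈ A, (∀ g : G, g * k * g⁻¹ * k⁻¹ ∈ Z) → k ∈ Z) : A ≤ Z := by
  obtain ⟨n, hn⟩ := Subgroup.nilpotent_iff_lowerCentralSeries.mp ‹Group.IsNilpotent G›
  have key : ∀ i, A ⊓ (⊤ : Subgroup G).lowerCentralSeries (n - i) ≤ Z := by
    intro i
    induction i with
    | zero => simp [hn]
    | succ i ih =>
      rintro k ⟨hkA, hki⟩
      refine h k hkA fun g => ih ⟨?_, ?_⟩
      · exact A.mul_mem (‹A.Normal›.conj_mem k hkA g) (A.inv_mem hkA)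
      · exact Subgroup.lowerCentralSeries_antitone _ (by omega : n - i ≤ n - (i + 1) + 1)
          (conj_mul_inv_mem_lowerCentralSeries_succ hki g)
  simpa using key n

theorem normal_V {G : Type*} [Group G] {φ : G → ℂ} (hφ : ∀ g k, φ (g * k * g⁻¹) = φ k) :
    (V φ).Normal := by
  refine ⟨fun k hk g => ?_⟩
  induction hk using Subgroup.closure_induction with
  | mem x hx => exact Subgroup.subset_closure (by simpa [hφ] using hx)
  | one => simp
  | mul x y _ _ hx hy => simpa using mul_mem hx hy
  | inv x _ hx => simpa [mul_assoc] using inv_mem hx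

end FiniteGroupChar

open Module Representation FiniteGroupChar in
theorem theoremA {G : Type*} [Group G] [Fintype G] {p : ℕ} [Fact p.Prime] (hG : IsPGroup p G)
    (χ ψ : G → ℂ) (hχ : χ ∈ FiniteGroupChar.Irr G) (hψ : ψ ∈ FiniteGroupChar.Irr G)
    (hη : FiniteGroupChar.eta (χ * ψ) < (p : ℕ∞))
    (θ : G → ℂ) (hθ : θ ∈ FiniteGroupChar.constituents (χ * ψ)) :
    FiniteGroupChar.center (χ * ψ) = FiniteGroupChar.center θ ∧
      FiniteGroupChar.V θ ≤ FiniteGroupChar.V (χ * ψ) ∧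
      FiniteGroupChar.V θ ≤ FiniteGroupChar.V χ ⊓ FiniteGroupChar.V ψ := by
  obtain ⟨U, _, _, _, ρ, hρ, rfl⟩ := hχ
  obtain ⟨W, _, _, _, σ, hσ, rfl⟩ := hψ
  obtain ⟨I, m, hI, hm, hsum⟩ := exists_eq_sum_constituents (ρ.tprod σ)
  rw [char_tensor] at hI hsum
  have hIrr : ∀ θ ∈ I, θ ∈ Irr G := fun θ h => by
    have h' : θ ∈ constituents (ρ.character * σ.character) := hI ▸ Finset.mem_coe.mpr h
    exact h'.1
  have hcard : I.card < p := by
    rw [eta, ← hI, Set.encard_coe_eq_coe_finsetCard] at hη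
    exact_mod_cast hη
  have hθI : θ ∈ I := by rwa [← Finset.mem_coe, hI]
  have hnil : Group.IsNilpotent G := hG.isNilpotent
  have vanish : ∀ K N : Subgroup G, ∀ [K.Normal] [N.Normal],
      (∀ k ∈ K, ∀ g : G, g * k * g⁻¹ * k⁻¹ ∈ N) →
      (∀ k ∈ K, k ∉ N → (ρ.character * σ.character) k = 0) →
      ∀ k ∈ K, k ∉ N → θ k = 0 := fun K N _ _ h1 h2 k hk hkN =>
    constituent_eq_zero_of_commutator_le hG hIrr hm hsum hcard h1 h2 hθI hk hkN
  have hV : V θ ≤ V (ρ.character * σ.character) := by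
    have hN : (V (ρ.character * σ.character)).Normal := by
      exact normal_V fun g k => by simp
    have hoff : ∀ k, k ∉ V (ρ.character * σ.character) → (ρ.character * σ.character) k = 0 :=
      fun k hk => not_not.mp fun h => hk (Subgroup.subset_closure h)
    generalize V (ρ.character * σ.character) = N at hN hoff
    -- `θ` vanishes off `γₙ(G) N` for every term `γₙ(G)` of the lower central series, since the
    -- sections `γₙ(G) N / γₙ₊₁(G) N` are central.
    have key : ∀ n, ∀ g, θ g ≠ 0 → g ∈ (⊤ : Subgroup G).lowerCentralSeries n ⊔ N := by
      intro n
      induction n with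
      | zero => simp
      | succ n ih =>
        intro g hg
        by_contra hgN
        refine hg (vanish _ _ ?_ ?_ g (ih g hg) hgN)
        · intro k hk
          rw [← mem_comap_mk_center_iff]
          refine (sup_le ?_ ?_ : (⊤ : Subgroup G).lowerCentralSeries n ⊔ N ≤ _) hk
          · intro x hx
            rw [mem_comap_mk_center_iff]
            intro y
            exact Subgroup.mem_sup_left (conj_mul_inv_mem_lowerCentralSeries_succ hx y)
          · intro x hx
            rw [mem_comap_mk_center_iff]
            exact fun y => Subgroup.mem_sup_right
              (N.mul_mem (hN.conj_mem x hx y) (N.inv_mem hx))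
        · exact fun k _ hk => hoff k fun h => hk (Subgroup.mem_sup_right h)
    obtain ⟨n, hn⟩ := Subgroup.nilpotent_iff_lowerCentralSeries.mp hnil
    refine (Subgroup.closure_le _).mpr fun g hg => ?_
    simpa [hn] using key n g hg
  have hZ : center (ρ.character * σ.character) ⊆ center θ :=
    hsum ▸ center_sum_subset hIrr hm hθI
  refine ⟨hZ.antisymm ?_, hV, hV.trans (le_inf ?_ ?_)⟩
  · obtain ⟨X, _, _, _, τ, hτ, rfl⟩ := hθ.1
    rw [center_mul, ← coe_scalarSubgroup, SetLike.coe_subset_coe]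
    refine le_of_forall_mem_of_commutator fun k hkτ hk => ?_
    by_contra hkZ
    -- `k` lies in the preimage `K` of the center of `G / Z`, where `Z = Z(χψ)`, and `χψ` vanishes
    -- on `K \ Z`.
    have h0 : τ.character k = 0 := by
      refine vanish ((Subgroup.center _).comap
        (QuotientGroup.mk' (scalarSubgroup ρ ⊓ scalarSubgroup σ)))
        (scalarSubgroup ρ ⊓ scalarSubgroup σ)
        (fun k hk => mem_comap_mk_center_iff.mp hk) ?_ k (mem_comap_mk_center_iff.mpr hk) hkZ
      intro x hx hxZ
      rw [mem_comap_mk_center_iff] at hx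
      by_contra hne
      obtain ⟨hρx, hσx⟩ := mul_ne_zero_iff.mp hne
      exact hxZ ⟨mem_scalarSubgroup_of_commutator ρ hρx fun g => (hx g).1,
        mem_scalarSubgroup_of_commutator σ hσx fun g => (hx g).2⟩
    have h1 : k ∈ center τ.character := coe_scalarSubgroup τ ▸ hkτ
    rw [center, Set.mem_ofPred, h0, char_one, norm_zero, Complex.ofReal_zero] at h1
    exact (finrank_pos_of_isIrreducible τ).ne (by exact_mod_cast h1)
  · exact Subgroup.closure_mono fun g hg => left_ne_zero_of_mul (b := σ.character g) hg
  · exact Subgroup.closure_mono fun g hg => right_ne_zero_of_mul (a := ρ.character g) hg
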